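/- All function spaces are real. For a probability space $(\Omega,\mu)$, a $P$-operator on $\Omega$ is a linear operator $A:L^\infty(\Omega)\to L^1(\Omega)$, written $v\mapsto vA$, with $\sup_{v\ne 0}\|vA\|_1/\|v\|_\infty<\infty$. For $p,q\in[1,\infty]$ put $$\|A\|_{p\to q}:=\sup_{v\in L^\infty(\Omega),\,v\neq 0}\|vA\|_q/\|v\|_p\in[0,\infty].$$ For $k\in\mathbb N$, the $k$-profile $\mathcal S_k(A)$ is the set of all joint distributions on $\mathbb R^{2k}$ of $(v_1,\dots,v_k,v_1A,\dots,v_kA)$, where $v_1,\dots,v_k$ run through the functions in $L^\infty(\Omega)$ with values in $[-1,1]$. Let $d_{\rm LP}$ be the Lévy–Prokhorov metric on the Borel probability measures on $\mathbb R^{2k}$ (with the Euclidean metric), and let $d_H$ be the corresponding Hausdorff distance of sets of such measures. A sequence $(A_i)_{i\ge1}$ of $P$-operators on probability spaces $\Omega_i$ (which may vary with $i$) is called action convergent if for every $k\in\mathbb N$ the sequence $(\mathcal S_k(A_i))_{i\ge1}$ is Cauchy in $d_H$. For $P$-operators $A,B$ on possibly different probability spaces put $$d_M(A,B):=\sum_{k=1}^\infty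 2^{-k}d_H(\mathcal S_k(A),\mathcal S_k(B)).$$ **Theorem (existence of limit object).** Let $p\in[1,\infty)$ and $q\in[1,\infty]$, and let $(A_i)_{i\ge1}$ be an action convergent sequence of $P$-operators with $\sup_i\|A_i\|_{p\to q}<\infty$. Then there is a $P$-operator $A$ on some probability space such that $$\lim_{i\to\infty}d_M(A_i,A)=0\qquad\text{and}\qquad \|A\|_{p\to q}\le\sup_{i}\|A_i\|_{p\to q}.$$ -/

import Mathlib

open MeasureTheory Filter Topology
open scoped ENNReal NNReal

noncomputable section

namespace ActionConvergence

universe u v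

/-- A `P`-operator on the probability space `(Ω, μ)`: a bounded linear operator
`L^∞(Ω) → L^1(Ω)` between real function spaces. -/
abbrev POperator {Ω : Type u} [MeasurableSpace Ω] (μ : Measure Ω) : Type u :=
  Lp ℝ ∞ μ →L[ℝ] Lp ℝ 1 μ

/-- The operator norm `‖A‖_{p→q} = sup_{v ∈ L^∞} ‖vA‖_q / ‖v‖_p`, with values in `[0, ∞]`.
The quotient for `v = 0` is `0 / 0 = 0` in `ℝ≥0∞`, so that `v = 0` does not contribute. -/
def opNorm {Ω : Type u} [MeasurableSpace Ω] {μ : Measure Ω} (p q : ℝ≥0∞)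
    (A : POperator μ) : ℝ≥0∞ :=
  ⨆ v : Lp ℝ ∞ μ, eLpNorm (A v) q μ / eLpNorm v p μ

/-- The random vector `(v_1, …, v_k, v_1 A, …, v_k A)`. The space `ℝ^{2k}` is the Euclidean
space whose coordinates are indexed by two copies of `Fin k`. -/
def jointVector {Ω : Type u} [MeasurableSpace Ω] {μ : Measure Ω} (A : POperator μ) {k : ℕ}
    (v : Fin k → Lp ℝ ∞ μ) (ω : Ω) : EuclideanSpace ℝ (Fin k ⊕ Fin k) :=
  WithLp.toLp 2 (Sum.elim (fun i => v i ω) (fun i => A (v i) ω))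

theorem measurable_jointVector {Ω : Type u} [MeasurableSpace Ω] {μ : Measure Ω}
    (A : POperator μ) {k : ℕ} (v : Fin k → Lp ℝ ∞ μ) : Measurable (jointVector A v) := by
  refine (WithLp.measurable_toLp 2 _).comp (measurable_pi_lambda _ ?_)
  rintro (i | i)
  · exact (Lp.stronglyMeasurable (v i)).measurable
  · exact (Lp.stronglyMeasurable (A (v i))).measurable

/-- The joint distribution `D_A(v_1, …, v_k)` of `v_1, …, v_k, v_1 A, …, v_k A`, as a point of
the space of Borel probability measures on `ℝ^{2k}` with the Lévy–Prokhorov metric. -/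
def jointLaw {Ω : Type u} [MeasurableSpace Ω] {μ : Measure Ω} [IsProbabilityMeasure μ]
    (A : POperator μ) {k : ℕ} (v : Fin k → Lp ℝ ∞ μ) :
    LevyProkhorov (ProbabilityMeasure (EuclideanSpace ℝ (Fin k ⊕ Fin k))) :=
  LevyProkhorov.ofMeasure
    ⟨μ.map (jointVector A v),
      Measure.isProbabilityMeasure_map (measurable_jointVector A v).aemeasurable⟩

/-- The `k`-profile `S_k(A)`: all joint distributions `D_A(v_1, …, v_k)`, where the `v_i` run
through the functions in `L^∞(Ω)` with values in `[-1, 1]`. -/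
def profile {Ω : Type u} [MeasurableSpace Ω] {μ : Measure Ω} [IsProbabilityMeasure μ]
    (A : POperator μ) (k : ℕ) :
    Set (LevyProkhorov (ProbabilityMeasure (EuclideanSpace ℝ (Fin k ⊕ Fin k)))) :=
  {η | ∃ v : Fin k → Lp ℝ ∞ μ, (∀ i, ∀ᵐ ω ∂μ, v i ω ∈ Set.Icc (-1 : ℝ) 1) ∧ η = jointLaw A v}

/-- Action convergence of a sequence of `P`-operators, each on its own probability space: for
every `k` the sequence of `k`-profiles is Cauchy in the Hausdorff distance `d_H` that belongs to
the Lévy–Prokhorov metric. (For `k = 0` the condition is void.) -/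
def ActionConvergent {Ω : ℕ → Type u} [∀ i, MeasurableSpace (Ω i)] {μ : ∀ i, Measure (Ω i)}
    [∀ i, IsProbabilityMeasure (μ i)] (A : ∀ i, POperator (μ i)) : Prop :=
  ∀ k : ℕ, ∀ ε : ℝ≥0∞, 0 < ε → ∃ N : ℕ, ∀ m ≥ N, ∀ n ≥ N,
    Metric.hausdorffEDist (profile (A m) k) (profile (A n) k) < ε

/-- `d_M(A, B) = ∑_{k ≥ 1} 2^{-k} d_H(S_k(A), S_k(B))`, for operators on possibly different
probability spaces. The sum is taken in `[0, ∞]`; the summation index is shifted by one. -/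
def dM {Ω : Type u} [MeasurableSpace Ω] {μ : Measure Ω} [IsProbabilityMeasure μ]
    {Ω' : Type v} [MeasurableSpace Ω'] {μ' : Measure Ω'} [IsProbabilityMeasure μ']
    (A : POperator μ) (B : POperator μ') : ℝ≥0∞ :=
  ∑' k : ℕ, (2⁻¹ : ℝ≥0∞) ^ (k + 1) *
    Metric.hausdorffEDist (profile A (k + 1)) (profile B (k + 1))

end ActionConvergence

end

noncomputable section

namespace ActionConvergence

universe u v

/-! ### Weak convergence: closed constraints and `L^r` norms. -/

section WeakLimits

variable {Z : Type*} [TopologicalSpace Z] [MeasurableSpace Z] [OpensMeasurableSpace Z]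

/-! The limit is built from a weak limit of the joint laws of countably many functions.
`exists_matching` transports a countable dense part of every profile to every `A i`, with an error
controlled by the Hausdorff distances. The resulting functions are closed under products and under
`v ↦ squash (v A)`; the formal expressions `Term β` remain countable. The joint law of all these
functions and of their images lives on `State β`. It is tight, since `‖vA‖₁ ≤ C` for unit functions
`v`, so Prokhorov's theorem gives a subsequential limit `ν`.

Three features of the states survive in the limit (`IsOperatorState.of_tendsto`): the product
identities, the `squash` identities and `‖xA‖_q ≤ C ‖x‖_p` on linear combinations. As `squash` is
injective, the second coordinates are almost surely functions of the first ones, so everything lives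
on the compact cube of first coordinates. There, products and Stone–Weierstrass make the span of the
coordinates dense in `L^p` (`denseRange_combLp`; this needs `p < ∞`), and the norm inequality
extends "coordinate ↦ image" to an operator.

Each profile element of `A m` is near the profile of the limit because the generators approximate it
(`exists_mem_profile_tendsto`). Conversely, a function on the cube is `L^p`-close to a linear
combination, which has a counterpart over each `A (φ i)`; truncating that to `[-1, 1]` costs little
(`eventually_exists_mem_profile`). The Cauchy property passes from the subsequence to the whole
sequence. -/

theorem ae_mem_of_tendsto_of_isClosed [HasOuterApproxClosed Z] {ν : ℕ → ProbabilityMeasure Z}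
    {ν' : ProbabilityMeasure Z} (hν : Tendsto ν atTop (𝓝 ν')) {F : Set Z} (hF : IsClosed F)
    (h : ∀ᶠ i in atTop, ∀ᵐ x ∂(ν i : Measure Z), x ∈ F) : ∀ᵐ x ∂(ν' : Measure Z), x ∈ F := by
  have h1 := ProbabilityMeasure.limsup_measure_closed_le_of_tendsto hν hF
  have h2 : (fun i => (ν i : Measure Z) F) =ᶠ[atTop] fun _ => 1 := by
    filter_upwards [h] with i hi
    exact prob_compl_eq_zero_iff hF.measurableSet |>.1 hi
  rw [limsup_congr h2, limsup_const] at h1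
  exact (prob_compl_eq_zero_iff hF.measurableSet).2 (le_antisymm prob_le_one h1)

/-- Portmanteau for open sets, applied to the superlevel sets of the continuous function `|h|^r`. No
boundedness is needed, which matters for the unbounded image coordinates. -/
theorem lintegral_enorm_rpow_le_liminf [HasOuterApproxClosed Z] {ν : ℕ → ProbabilityMeasure Z}
    {ν' : ProbabilityMeasure Z} (hν : Tendsto ν atTop (𝓝 ν')) {h : Z → ℝ} (hc : Continuous h)
    {r : ℝ} (hr : 0 ≤ r) :
    ∫⁻ x, ‖h x‖ₑ ^ r ∂(ν' : Measure Z) ≤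
      atTop.liminf fun i => ∫⁻ x, ‖h x‖ₑ ^ r ∂(ν i : Measure Z) := by
  have key : ∀ x, ‖h x‖ₑ ^ r = ENNReal.ofReal (|h x| ^ r) := fun x => by
    rw [← ENNReal.ofReal_rpow_of_nonneg (abs_nonneg _) hr, Real.enorm_eq_ofReal_abs]
  simp_rw [key]
  exact lintegral_le_liminf_lintegral_of_forall_isOpen_measure_le_liminf_measure
    (hc.abs.rpow_const fun _ => Or.inr hr) (fun x => by positivity)
    fun G hG => ProbabilityMeasure.le_liminf_measure_open_of_tendsto hν hG

/-- Lower semicontinuity of the `L^q`-seminorm of a continuous function under weak convergence. -/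
theorem eLpNorm_le_of_tendsto [HasOuterApproxClosed Z] {ν : ℕ → ProbabilityMeasure Z}
    {ν' : ProbabilityMeasure Z} (hν : Tendsto ν atTop (𝓝 ν')) {h : Z → ℝ} (hc : Continuous h)
    {q : ℝ≥0∞} (hq : q ≠ 0) {C : ℕ → ℝ≥0∞} {D : ℝ≥0∞}
    (hC : ∀ i, eLpNorm h q (ν i : Measure Z) ≤ C i) (hD : Tendsto C atTop (𝓝 D)) :
    eLpNorm h q (ν' : Measure Z) ≤ D := by
  rcases eq_or_ne q ∞ with rfl | hq'
  -- For `a > D` the closed set `{‖h‖ ≤ a}` eventually has full measure, hence also has full measure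
  -- in the limit.
  · refine le_of_forall_gt_imp_ge_of_dense fun a ha => ?_
    rw [eLpNorm_exponent_top]
    refine essSup_le_of_ae_le a ?_
    refine ae_mem_of_tendsto_of_isClosed hν (F := {x | ‖h x‖ₑ ≤ a})
      (isClosed_le (by fun_prop) continuous_const) ?_
    filter_upwards [hD.eventually (gt_mem_nhds ha)] with i hi
    have := (hC i).trans hi.le
    rw [eLpNorm_exponent_top] at this
    filter_upwards [enorm_ae_le_eLpNormEssSup h (ν i : Measure Z)] with x hx
    exact hx.trans this
  · have hr : 0 < q.toReal := ENNReal.toReal_pos hq hq'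
    simp only [eLpNorm_eq_lintegral_rpow_enorm_toReal hq hq', one_div] at hC ⊢
    rw [ENNReal.rpow_inv_le_iff hr]
    refine (lintegral_enorm_rpow_le_liminf hν hc hr.le).trans ?_
    have h1 : Tendsto (fun i => C i ^ q.toReal) atTop (𝓝 (D ^ q.toReal)) := hD.ennrpow_const _
    rw [← h1.liminf_eq]
    refine liminf_le_liminf (Eventually.of_forall fun i => ?_)
    exact (ENNReal.rpow_inv_le_iff hr).1 (hC i)

/-- For finite `p` the function `|h|^p` is continuous, and bounded by compactness, so it is a test
function for weak convergence. An essential supremum would only be lower semicontinuous. -/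
theorem tendsto_eLpNorm_of_compactSpace [CompactSpace Z] {ν : ℕ → ProbabilityMeasure Z}
    {ν' : ProbabilityMeasure Z} (hν : Tendsto ν atTop (𝓝 ν')) {h : Z → ℝ} (hc : Continuous h)
    {p : ℝ≥0∞} (hp : p ≠ 0) (hp' : p ≠ ∞) :
    Tendsto (fun i => eLpNorm h p (ν i : Measure Z)) atTop
      (𝓝 (eLpNorm h p (ν' : Measure Z))) := by
  have hr : 0 < p.toReal := ENNReal.toReal_pos hp hp'
  simp only [eLpNorm_eq_lintegral_rpow_enorm_toReal hp hp']
  refine Tendsto.ennrpow_const _ ?_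
  let f : C(Z, ℝ≥0) := ⟨fun x => ‖h x‖₊ ^ p.toReal,
    (NNReal.continuous_rpow_const hr.le).comp (by fun_prop : Continuous fun x => ‖h x‖₊)⟩
  have hf : ∀ x, ‖h x‖ₑ ^ p.toReal = (f x : ℝ≥0∞) := fun x => by
    simp only [f, ContinuousMap.coe_mk, ENNReal.coe_rpow_of_nonneg _ hr.le]
    rfl
  simp_rw [hf]
  exact ((ProbabilityMeasure.continuous_lintegral_continuousMap f).tendsto ν').comp hν

end WeakLimits

/-! ### Lévy–Prokhorov estimates for joint laws. -/

section LevyProkhorovEstimates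

variable {Ω : Type u} [MeasurableSpace Ω] {μ : Measure Ω}

/-- `X` and `Y` form a coupling: outside the exceptional set, `X ∈ B` puts `Y` into every
`δ`-thickening of `B` with `δ > ε`. -/
theorem levyProkhorovEDist_map_le {E : Type*} [PseudoEMetricSpace E] [MeasurableSpace E]
    [OpensMeasurableSpace E] {X Y : Ω → E} (hX : Measurable X) (hY : Measurable Y) {ε : ℝ≥0∞}
    (h : μ {ω | ε ≤ edist (X ω) (Y ω)} ≤ ε) :
    levyProkhorovEDist (μ.map X) (μ.map Y) ≤ ε := by
  have aux : ∀ {X Y : Ω → E}, Measurable X → Measurable Y →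
      μ {ω | ε ≤ edist (X ω) (Y ω)} ≤ ε → ∀ (δ : ℝ≥0∞) (B : Set E), ε < δ → δ < ∞ →
      MeasurableSet B → μ.map X B ≤ μ.map Y (Metric.thickening δ.toReal B) + δ := by
    intro X Y hX hY h δ B hδ hδ' hB
    rw [Measure.map_apply hX hB, Measure.map_apply hY Metric.isOpen_thickening.measurableSet]
    calc μ (X ⁻¹' B) ≤ μ (Y ⁻¹' (Metric.thickening δ.toReal B) ∪ {ω | ε ≤ edist (X ω) (Y ω)}) := by
          refine measure_mono fun ω hω => ?_
          by_cases hε : ε ≤ edist (X ω) (Y ω)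
          · exact Or.inr hε
          · left
            rw [Set.mem_preimage, Metric.mem_thickening_iff_exists_edist_lt]
            refine ⟨X ω, hω, ?_⟩
            rw [ENNReal.ofReal_toReal hδ'.ne, edist_comm]
            exact (not_le.1 hε).trans hδ
      _ ≤ _ := (measure_union_le _ _).trans (add_le_add le_rfl (h.trans hδ.le))
  refine levyProkhorovEDist_le_of_forall _ _ _ fun δ B hδ hδ' hB => ⟨aux hX hY h δ B hδ hδ' hB, ?_⟩
  refine aux hY hX ?_ δ B hδ hδ' hB
  simpa only [edist_comm] using h

theorem enorm_toLp_le_sum {ι : Type*} [Fintype ι] (x : ι → ℝ) :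
    ‖(WithLp.toLp 2 x : EuclideanSpace ℝ ι)‖ₑ ≤ ∑ i, ‖x i‖ₑ := by
  have h : ‖(WithLp.toLp 2 x : EuclideanSpace ℝ ι)‖ ≤ ∑ i, ‖x i‖ := by
    rw [EuclideanSpace.norm_eq]
    refine Real.sqrt_le_iff.2 ⟨by positivity, ?_⟩
    exact Finset.sum_sq_le_sq_sum_of_nonneg fun i _ => norm_nonneg _
  simp only [← ofReal_norm]
  rw [← ENNReal.ofReal_sum_of_nonneg fun i _ => norm_nonneg _]
  exact ENNReal.ofReal_le_ofReal h

theorem lintegral_edist_jointVector_le (A : POperator μ) {k : ℕ} (v w : Fin k → Lp ℝ ∞ μ) :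
    ∫⁻ ω, edist (jointVector A v ω) (jointVector A w ω) ∂μ ≤
      ∑ j, (eLpNorm (v j - w j) 1 μ + eLpNorm (A (v j) - A (w j)) 1 μ) := by
  have h1 : ∀ ω, edist (jointVector A v ω) (jointVector A w ω) ≤
      ∑ j, (‖v j ω - w j ω‖ₑ + ‖A (v j) ω - A (w j) ω‖ₑ) := fun ω => by
    rw [edist_eq_enorm_sub, jointVector, jointVector, ← WithLp.toLp_sub]
    refine (enorm_toLp_le_sum _).trans ?_
    simp [Fintype.sum_sum_type, Finset.sum_add_distrib]
  refine (lintegral_mono h1).trans ?_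
  have m0 : ∀ j, Measurable fun ω => ‖v j ω - w j ω‖ₑ := fun j =>
    ((Lp.stronglyMeasurable (v j)).measurable.sub (Lp.stronglyMeasurable (w j)).measurable).enorm
  have m1 : ∀ j, Measurable fun ω => ‖A (v j) ω - A (w j) ω‖ₑ := fun j =>
    ((Lp.stronglyMeasurable (A (v j))).measurable.sub
      (Lp.stronglyMeasurable (A (w j))).measurable).enorm
  rw [lintegral_finsetSum _ fun j _ => by exact (m0 j).add (m1 j)]
  refine Finset.sum_le_sum fun j _ => ?_
  rw [lintegral_add_left (m0 j), eLpNorm_one_eq_lintegral_enorm, eLpNorm_one_eq_lintegral_enorm]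
  refine (congrArg₂ _ (lintegral_congr_ae ?_) (lintegral_congr_ae ?_)).le
  · filter_upwards [Lp.coeFn_sub (v j) (w j)] with ω h
    rw [h, Pi.sub_apply]
  · filter_upwards [Lp.coeFn_sub (A (v j)) (A (w j))] with ω h
    rw [h, Pi.sub_apply]

/-- Markov's inequality bounds `ε · μ(distance ≥ ε)` by `ε²`; cancelling `ε` gives the coupling
condition. -/
theorem edist_jointLaw_le [IsProbabilityMeasure μ] (A : POperator μ) {k : ℕ} (v w : Fin k → Lp ℝ ∞ μ) {ε : ℝ≥0∞}
    (hε : ε ≠ 0) (hε' : ε ≠ ∞)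
    (h : ∑ j, (eLpNorm (v j - w j) 1 μ + eLpNorm (A (v j) - A (w j)) 1 μ) ≤ ε * ε) :
    edist (jointLaw A v) (jointLaw A w) ≤ ε := by
  rw [LevyProkhorov.edist_probabilityMeasure_def]
  refine levyProkhorovEDist_map_le (measurable_jointVector A v) (measurable_jointVector A w) ?_
  have h2 := mul_meas_ge_le_lintegral (μ := μ)
    ((measurable_jointVector A v).edist (measurable_jointVector A w)) ε
  have h3 := (h2.trans (lintegral_edist_jointVector_le A v w)).trans h
  exact (ENNReal.mul_le_mul_iff_right hε hε').1 h3

theorem eLpNorm_one_apply_le (A : POperator μ) {v : Lp ℝ ∞ μ}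
    (hv : ∀ᵐ ω ∂μ, v ω ∈ Set.Icc (-1 : ℝ) 1) : eLpNorm (A v) 1 μ ≤ ENNReal.ofReal ‖A‖ := by
  have h1 : ‖v‖ ≤ 1 := by
    rw [Lp.norm_def]
    refine ENNReal.toReal_le_of_le_ofReal zero_le_one ?_
    rw [eLpNorm_exponent_top]
    refine eLpNormEssSup_le_of_ae_bound ?_
    filter_upwards [hv] with ω hω
    exact abs_le.2 hω
  have h2 : ‖A v‖ ≤ ‖A‖ := (A.le_opNorm v).trans (by nlinarith [norm_nonneg A])
  rw [Lp.norm_def] at h2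
  exact (ENNReal.le_ofReal_iff_toReal_le (Lp.eLpNorm_ne_top _) (norm_nonneg _)).2 h2

/-- The joint vectors are bounded in `L^1` uniformly over the profile, so the profile is tight by
Markov and relatively compact by Prokhorov. -/
theorem isSeparable_profile [IsProbabilityMeasure μ] (A : POperator μ) (k : ℕ) :
    TopologicalSpace.IsSeparable (profile A k) := by
  let C : ℝ≥0∞ := ∑ _j : Fin k, (1 + ENNReal.ofReal ‖A‖)
  have hCtop : C ≠ ∞ := ENNReal.sum_ne_top.2 fun _ _ => by simp
  let S : Set (ProbabilityMeasure (EuclideanSpace ℝ (Fin k ⊕ Fin k))) :=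
    LevyProkhorov.ofMeasure ⁻¹' profile A k
  have hS : IsTightMeasureSet {((ν : ProbabilityMeasure _) : Measure (EuclideanSpace ℝ (Fin k ⊕ Fin k))) | ν ∈ S} := by
    rw [isTightMeasureSet_iff_exists_isCompact_measure_compl_le]
    intro ε hε
    obtain ⟨R, hR⟩ : ∃ R : ℝ≥0, C / R ≤ ε ∧ R ≠ 0 := by
      rcases eq_or_ne ε ∞ with rfl | hε'
      · exact ⟨1, le_top, one_ne_zero⟩
      · have : C / ε ≠ ∞ := ENNReal.div_ne_top hCtop hε.ne'
        refine ⟨(C / ε).toNNReal + 1, ?_, by positivity⟩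
        refine ENNReal.div_le_of_le_mul ?_
        rw [ENNReal.coe_add, ENNReal.coe_toNNReal this, mul_add, ENNReal.mul_div_cancel hε.ne' hε']
        exact le_self_add
    refine ⟨Metric.closedBall 0 R, isCompact_closedBall _ _, ?_⟩
    rintro _ ⟨ν, ⟨v, hv, hν⟩, rfl⟩
    have hν' : (ν : Measure (EuclideanSpace ℝ (Fin k ⊕ Fin k))) = μ.map (jointVector A v) :=
      congrArg (fun η : ProbabilityMeasure (EuclideanSpace ℝ (Fin k ⊕ Fin k)) =>
        (η : Measure (EuclideanSpace ℝ (Fin k ⊕ Fin k)))) (congrArg LevyProkhorov.toMeasure hν)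
    rw [hν', Measure.map_apply (measurable_jointVector A v)
      Metric.isClosed_closedBall.measurableSet.compl]
    have h1 : jointVector A v ⁻¹' (Metric.closedBall 0 (R : ℝ))ᶜ ⊆
        {ω | (R : ℝ≥0∞) ≤ edist (jointVector A v ω) 0} := by
      intro ω hω
      simp only [Set.mem_preimage, Set.mem_compl_iff, Metric.mem_closedBall, not_le] at hω
      simp only [Set.mem_ofPred_eq]
      rw [edist_dist, ← ENNReal.ofReal_coe_nnreal]
      exact ENNReal.ofReal_le_ofReal hω.le
    refine (measure_mono h1).trans ?_
    have h2 : ∫⁻ ω, edist (jointVector A v ω) 0 ∂μ ≤ C := by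
      -- Writing the origin as a value at the zero tuple reduces the first moment to the estimate
      -- for two tuples.
      have h3 : ∀ ω, (0 : EuclideanSpace ℝ (Fin k ⊕ Fin k)) =
          jointVector A (0 : Fin k → Lp ℝ ∞ μ) ω := fun ω => by
        ext i
        rcases i with i | i <;> simp [jointVector]
      rw [lintegral_congr fun ω => congrArg (edist _) (h3 ω)]
      refine (lintegral_edist_jointVector_le A v 0).trans (Finset.sum_le_sum fun j _ => ?_)
      have h4 : eLpNorm (v j - (0 : Fin k → Lp ℝ ∞ μ) j) 1 μ ≤ 1 := by
        rw [eLpNorm_one_eq_lintegral_enorm]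
        refine (lintegral_mono_ae (g := fun _ => 1) ?_).trans (by simp)
        filter_upwards [hv j] with ω h
        rw [Pi.zero_apply, sub_zero, Real.enorm_eq_ofReal_abs]
        exact ENNReal.ofReal_le_one.2 (abs_le.2 h)
      refine add_le_add h4 ?_
      rw [Pi.zero_apply, map_zero, sub_zero]
      exact eLpNorm_one_apply_le A (hv j)
    have h6 := mul_meas_ge_le_lintegral (μ := μ)
      ((measurable_jointVector A v).edist (measurable_const (a := 0))) R
    refine le_trans ?_ hR.1
    rw [ENNReal.le_div_iff_mul_le (Or.inl (by simpa using hR.2)) (Or.inl ENNReal.coe_ne_top),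
      mul_comm]
    exact h6.trans h2
  have hc := isCompact_closure_of_isTightMeasureSet hS
  have hc' := hc.image LevyProkhorov.continuous_ofMeasure_probabilityMeasure
  refine hc'.isSeparable.mono fun η hη => ⟨η.toMeasure, subset_closure hη, rfl⟩

theorem eLpNorm_apply_le_opNorm_mul [IsFiniteMeasure μ] {p q : ℝ≥0∞} (hp : p ≠ 0) (A : POperator μ) (v : Lp ℝ ∞ μ) :
    eLpNorm (A v) q μ ≤ opNorm p q A * eLpNorm v p μ := by
  by_cases h0 : eLpNorm v p μ = 0
  · have h1 : v = 0 := by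
      rw [eLpNorm_eq_zero_iff (Lp.aestronglyMeasurable _) hp] at h0
      exact (Lp.eq_zero_iff_ae_eq_zero).2 h0
    subst h1
    rw [map_zero, eLpNorm_congr_ae (Lp.coeFn_zero ℝ 1 μ)]
    simp
  · have h1 : eLpNorm v p μ ≠ ∞ := ((Lp.memLp v).mono_exponent le_top).eLpNorm_ne_top
    rw [← ENNReal.div_le_iff h0 h1]
    exact le_iSup (fun v : Lp ℝ ∞ μ => eLpNorm (A v) q μ / eLpNorm v p μ) v

end LevyProkhorovEstimates

/-! ### Encoding unbounded values in `[-1, 1]`, and unit functions. -/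

/-- A homeomorphism of `ℝ` onto `(-1, 1)`. -/
def squash (x : ℝ) : ℝ := x / (1 + |x|)

/-- The inverse of `squash` on `(-1, 1)`. -/
def unsquash (y : ℝ) : ℝ := y / (1 - |y|)

theorem continuous_squash : Continuous squash :=
  continuous_id.div (by fun_prop) fun x => by positivity

theorem measurable_unsquash : Measurable unsquash := by
  unfold unsquash
  fun_prop

theorem squash_mem_Icc (x : ℝ) : squash x ∈ Set.Icc (-1 : ℝ) 1 := by
  have h : 0 < 1 + |x| := by positivity
  rw [squash, Set.mem_Icc, le_div_iff₀ h, div_le_iff₀ h]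
  exact ⟨by linarith [neg_abs_le x], by linarith [le_abs_self x]⟩

theorem unsquash_squash (x : ℝ) : unsquash (squash x) = x := by
  have h : 0 < 1 + |x| := by positivity
  rw [unsquash, squash, abs_div, abs_of_pos h]
  field_simp
  ring

/-- Functions in `L^∞` with values in `[-1, 1]`. -/
abbrev UnitFun {Ω : Type u} [MeasurableSpace Ω] (μ : Measure Ω) : Type u :=
  {v : Lp ℝ ∞ μ // ∀ᵐ ω ∂μ, v ω ∈ Set.Icc (-1 : ℝ) 1}

section UnitFun

variable {Ω : Type u} [MeasurableSpace Ω] {μ : Measure Ω}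

theorem memLp_of_ae_mem_Icc {f : Ω → ℝ} (hf : AEStronglyMeasurable f μ)
    (h : ∀ᵐ ω ∂μ, f ω ∈ Set.Icc (-1 : ℝ) 1) : MemLp f ∞ μ :=
  memLp_top_of_bound hf 1 (h.mono fun _ hω => abs_le.2 hω)

/-- The class in `L^∞` of a function with values in `[-1, 1]`. -/
def UnitFun.of (f : Ω → ℝ) (hf : AEStronglyMeasurable f μ)
    (h : ∀ᵐ ω ∂μ, f ω ∈ Set.Icc (-1 : ℝ) 1) : UnitFun μ :=
  ⟨(memLp_of_ae_mem_Icc hf h).toLp f, by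
    filter_upwards [(memLp_of_ae_mem_Icc hf h).coeFn_toLp, h] with ω h1 h2
    rwa [h1]⟩

theorem UnitFun.coeFn_of (f : Ω → ℝ) (hf : AEStronglyMeasurable f μ)
    (h : ∀ᵐ ω ∂μ, f ω ∈ Set.Icc (-1 : ℝ) 1) : (UnitFun.of f hf h).1 =ᵐ[μ] f :=
  (memLp_of_ae_mem_Icc hf h).coeFn_toLp

/-- The truncation of a function at the levels `-1` and `1`. -/
def UnitFun.clamp (v : Lp ℝ ∞ μ) : UnitFun μ :=
  UnitFun.of (fun ω => (Set.projIcc (-1 : ℝ) 1 (by norm_num) (v ω) : ℝ))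
    (by
      have : Continuous fun x : ℝ => (Set.projIcc (-1 : ℝ) 1 (by norm_num) x : ℝ) :=
        continuous_subtype_val.comp continuous_projIcc
      exact this.comp_aestronglyMeasurable (Lp.aestronglyMeasurable v))
    (Eventually.of_forall fun _ => Subtype.prop _)

theorem UnitFun.eLpNorm_le_one [IsProbabilityMeasure μ] (v : UnitFun μ) (p : ℝ≥0∞) :
    eLpNorm v.1 p μ ≤ 1 := by
  refine (eLpNorm_le_of_ae_bound (C := 1) (v.2.mono fun _ hω => abs_le.2 hω)).trans ?_
  simp

theorem coeFn_linearCombination {T : Type*} {p : ℝ≥0∞} (g : T → Lp ℝ p μ) (x : T →₀ ℝ) :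
    ⇑(Finsupp.linearCombination ℝ g x) =ᵐ[μ] fun ω => x.sum fun t a => a * g t ω := by
  rw [Finsupp.linearCombination_apply, Finsupp.sum]
  refine (Lp.coeFn_finsetSum _ _).trans ?_
  have h : ∀ᵐ ω ∂μ, ∀ t ∈ x.support, (x t • g t : Lp ℝ p μ) ω = x t * g t ω := by
    rw [Finset.eventually_all]
    intro t _
    filter_upwards [Lp.coeFn_smul (x t) (g t)] with ω hω
    rw [hω]
    rfl
  filter_upwards [h] with ω hω
  rw [Finset.sum_apply]
  exact Finset.sum_congr rfl hω

end UnitFun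

/-! ### Formal expressions and the laws of states. -/

/-- Formal expressions for the functions that are generated from a family of basic functions by
products and by the operation `v ↦ squash (v A)`. -/
inductive Term (β : Type) : Type
  | one : Term β
  | base : β → Term β
  | mul : Term β → Term β → Term β
  | sq : Term β → Term β
  deriving Countable

/-- The space of the joint values of all `v` and all `v A`, where `v` runs through the functions
given by formal expressions. -/
abbrev State (β : Type) : Type := (Term β → Set.Icc (-1 : ℝ) 1) × (Term β → ℝ)

section Eval

variable {Ω : Type u} [MeasurableSpace Ω] {μ : Measure Ω} {β : Type}

/-- A finite linear combination of first coordinates. -/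
def comb (x : Term β →₀ ℝ) (y : Term β → Set.Icc (-1 : ℝ) 1) : ℝ :=
  x.sum fun t a => a * (y t : ℝ)

/-- A finite linear combination of second coordinates. -/
def combImage (x : Term β →₀ ℝ) (y : Term β → ℝ) : ℝ :=
  x.sum fun t a => a * y t

theorem continuous_comb (x : Term β →₀ ℝ) : Continuous (comb x) := by
  unfold comb Finsupp.sum
  fun_prop

theorem continuous_combImage (x : Term β →₀ ℝ) : Continuous (combImage x) := by
  unfold combImage Finsupp.sum
  fun_prop

/-- The function denoted by a formal expression. -/
def eval (A : POperator μ) (b : β → UnitFun μ) : Term β → UnitFun μ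
  | .one => UnitFun.of (fun _ => 1) aestronglyMeasurable_const (by simp)
  | .base j => b j
  | .mul s t => UnitFun.of ((eval A b s).1 * (eval A b t).1 : Ω → ℝ)
      ((Lp.aestronglyMeasurable _).mul (Lp.aestronglyMeasurable _)) (by
        filter_upwards [(eval A b s).2, (eval A b t).2] with ω h1 h2
        rw [Set.mem_Icc, ← abs_le] at h1 h2 ⊢
        rw [Pi.mul_apply, abs_mul]
        exact mul_le_one₀ h1 (abs_nonneg _) h2)
  | .sq t => UnitFun.of (fun ω => squash (A (eval A b t).1 ω))
      (continuous_squash.comp_aestronglyMeasurable (Lp.aestronglyMeasurable _))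
      (Eventually.of_forall fun _ => squash_mem_Icc _)

/-- The values of all functions given by formal expressions and of their images. -/
def stateMap (A : POperator μ) (b : β → UnitFun μ) (ω : Ω) : State β :=
  (fun t => Set.projIcc (-1 : ℝ) 1 (by norm_num) ((eval A b t).1 ω),
    fun t => A (eval A b t).1 ω)

theorem measurable_stateMap (A : POperator μ) (b : β → UnitFun μ) :
    Measurable (stateMap A b) := by
  refine Measurable.prodMk (measurable_pi_lambda _ fun t => ?_) (measurable_pi_lambda _ fun t => ?_)
  · exact continuous_projIcc.measurable.comp (Lp.stronglyMeasurable _).measurable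
  · exact (Lp.stronglyMeasurable _).measurable

theorem stateMap_fst_ae (A : POperator μ) (b : β → UnitFun μ) (t : Term β) :
    ∀ᵐ ω ∂μ, ((stateMap A b ω).1 t : ℝ) = (eval A b t).1 ω := by
  filter_upwards [(eval A b t).2] with ω hω
  simp only [stateMap]
  rw [Set.projIcc_of_mem _ hω]

theorem coeFn_eval_comb (A : POperator μ) (b : β → UnitFun μ) (x : Term β →₀ ℝ) :
    ⇑(Finsupp.linearCombination ℝ (fun t => (eval A b t).1) x) =ᵐ[μ]
      fun ω => comb x (stateMap A b ω).1 := by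
  refine (coeFn_linearCombination _ x).trans ?_
  have h : ∀ᵐ ω ∂μ, ∀ t ∈ x.support, ((stateMap A b ω).1 t : ℝ) = (eval A b t).1 ω := by
    rw [Finset.eventually_all]
    exact fun t _ => stateMap_fst_ae A b t
  filter_upwards [h] with ω hω
  exact Finset.sum_congr rfl fun t ht => by simp only [hω t ht]

theorem coeFn_apply_eval_comb (A : POperator μ) (b : β → UnitFun μ) (x : Term β →₀ ℝ) :
    ⇑(A (Finsupp.linearCombination ℝ (fun t => (eval A b t).1) x)) =ᵐ[μ]
      fun ω => combImage x (stateMap A b ω).2 := by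
  have h : A (Finsupp.linearCombination ℝ (fun t => (eval A b t).1) x) =
      Finsupp.linearCombination ℝ (fun t => A (eval A b t).1) x := by
    simp [Finsupp.linearCombination_apply, Finsupp.sum, map_sum]
  rw [h]
  exact coeFn_linearCombination _ x

variable [IsProbabilityMeasure μ]

/-- The distribution of the random state. -/
def stateLaw (A : POperator μ) (b : β → UnitFun μ) : ProbabilityMeasure (State β) :=
  ⟨μ.map (stateMap A b),
    Measure.isProbabilityMeasure_map (measurable_stateMap A b).aemeasurable⟩

theorem ae_stateLaw {A : POperator μ} {b : β → UnitFun μ} {F : Set (State β)}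
    (h : ∀ᵐ ω ∂μ, stateMap A b ω ∈ F) (hF : MeasurableSet F) :
    ∀ᵐ z ∂(stateLaw A b : Measure (State β)), z ∈ F :=
  (ae_map_iff (measurable_stateMap A b).aemeasurable hF).2 h

/-- The first factor is compact. In the second, Markov allows a failure probability `δ t` for each
term, with total below `ε`; the product of the resulting balls is compact by Tychonoff. -/
theorem isTightMeasureSet_stateLaw [Countable β] {Ω : ℕ → Type u} [∀ i, MeasurableSpace (Ω i)]
    {μ : ∀ i, Measure (Ω i)} [∀ i, IsProbabilityMeasure (μ i)] (A : ∀ i, POperator (μ i))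
    (b : ∀ i, β → UnitFun (μ i)) {C : ℝ≥0∞} (hC : C ≠ ∞)
    (h : ∀ i, ∀ v : UnitFun (μ i), eLpNorm (A i v.1) 1 (μ i) ≤ C) :
    IsTightMeasureSet {((ν : ProbabilityMeasure _) : Measure (State β)) |
      ν ∈ Set.range fun i => stateLaw (A i) (b i)} := by
  rw [isTightMeasureSet_iff_exists_isCompact_measure_compl_le]
  intro ε hε
  obtain ⟨δ, hδ, hδ'⟩ := ENNReal.exists_pos_sum_of_countable' hε.ne' (Term β)
  have hM : ∀ t, ∃ M : ℝ≥0, C / M ≤ δ t ∧ M ≠ 0 := by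
    intro t
    rcases eq_or_ne (δ t) ∞ with h' | h'
    · exact ⟨1, h' ▸ le_top, one_ne_zero⟩
    · have h0 : C / δ t ≠ ∞ := ENNReal.div_ne_top hC (hδ t).ne'
      refine ⟨(C / δ t).toNNReal + 1, ?_, by positivity⟩
      refine ENNReal.div_le_of_le_mul ?_
      rw [ENNReal.coe_add, ENNReal.coe_toNNReal h0, mul_add, ENNReal.mul_div_cancel (hδ t).ne' h']
      exact le_self_add
  choose M hM hM' using hM
  refine ⟨Set.univ ×ˢ Set.univ.pi fun t => Metric.closedBall 0 (M t),
    isCompact_univ.prod (isCompact_univ_pi fun t => isCompact_closedBall _ _), ?_⟩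
  rintro _ ⟨_, ⟨i, rfl⟩, rfl⟩
  have hm : MeasurableSet ((Set.univ : Set (Term β → Set.Icc (-1 : ℝ) 1)) ×ˢ
      Set.univ.pi fun t : Term β => Metric.closedBall (0 : ℝ) (M t)) :=
    MeasurableSet.univ.prod (MeasurableSet.univ_pi fun t => Metric.isClosed_closedBall.measurableSet)
  change (μ i).map (stateMap (A i) (b i)) _ ≤ ε
  rw [Measure.map_apply (measurable_stateMap _ _) hm.compl]
  refine (measure_mono (t := ⋃ t, {ω | (M t : ℝ≥0∞) ≤ ‖A i (eval (A i) (b i) t).1 ω‖ₑ}) ?_).trans ?_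
  · intro ω hω
    simp only [Set.mem_preimage, Set.mem_compl_iff, Set.mem_prod, Set.mem_univ, true_and,
      Set.mem_pi, forall_const, not_forall, Metric.mem_closedBall, dist_zero_right, not_le] at hω
    obtain ⟨t, ht⟩ := hω
    refine Set.mem_iUnion.2 ⟨t, ?_⟩
    rw [Set.mem_ofPred_eq, ← ofReal_norm, ← ENNReal.ofReal_coe_nnreal]
    exact ENNReal.ofReal_le_ofReal ht.le
  · refine (measure_iUnion_le _).trans ((ENNReal.tsum_le_tsum fun t => ?_).trans hδ'.le)
    refine le_trans ?_ (hM t)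
    rw [ENNReal.le_div_iff_mul_le (Or.inl (by simpa using hM' t)) (Or.inl ENNReal.coe_ne_top),
      mul_comm]
    have h2 := mul_meas_ge_le_lintegral (μ := μ i)
      ((Lp.stronglyMeasurable (A i (eval (A i) (b i) t).1)).measurable.enorm) (M t)
    refine h2.trans ?_
    rw [← eLpNorm_one_eq_lintegral_enorm]
    exact h i _

end Eval

/-! ### From `L^p` estimates to distances of joint laws. -/

section Inclusion

variable {Ω : Type u} [MeasurableSpace Ω] {μ : Measure Ω} [IsProbabilityMeasure μ]

/-- The inclusion of `L^∞` in `L^p` on a probability space. -/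
def inclusionLp (μ : Measure Ω) [IsProbabilityMeasure μ] (p : ℝ≥0∞) [Fact (1 ≤ p)] :
    Lp ℝ ∞ μ →L[ℝ] Lp ℝ p μ :=
  LinearMap.mkContinuous
    { toFun := fun v => ⟨v.1, Lp.antitone le_top v.2⟩
      map_add' := fun _ _ => rfl
      map_smul' := fun _ _ => rfl } 1 fun v => by
    rw [one_mul, Lp.norm_def, Lp.norm_def]
    refine ENNReal.toReal_mono (Lp.eLpNorm_ne_top v) ?_
    exact eLpNorm_le_eLpNorm_of_exponent_le le_top (Lp.aestronglyMeasurable v)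

/-- On a probability space both `L^p` and `L^q` norms dominate the `L^1` norm, so each index
contributes at most `δ + C * δ` to the `L^1` distance. -/
theorem edist_jointLaw_le_of_eLpNorm_le {p q : ℝ≥0∞} (hp : 1 ≤ p) (hq : 1 ≤ q) {C : ℝ≥0∞}
    {A : POperator μ} (hA : ∀ v, eLpNorm (A v) q μ ≤ C * eLpNorm v p μ)
    {k : ℕ} {v w : Fin k → Lp ℝ ∞ μ} {δ ε : ℝ≥0∞} (hε : ε ≠ 0) (hε' : ε ≠ ∞)
    (hδ : k * (δ + C * δ) ≤ ε * ε) (h : ∀ j, eLpNorm (v j - w j : Lp ℝ ∞ μ) p μ ≤ δ) :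
    edist (jointLaw A v) (jointLaw A w) ≤ ε := by
  refine edist_jointLaw_le A v w hε hε' (le_trans ?_ hδ)
  refine (Finset.sum_le_card_nsmul _ _ (δ + C * δ) fun j _ => ?_).trans (by simp [mul_add])
  refine add_le_add ?_ ?_
  · exact (eLpNorm_le_eLpNorm_of_exponent_le hp (Lp.aestronglyMeasurable _)).trans (h j)
  · rw [← map_sub]
    refine (eLpNorm_le_eLpNorm_of_exponent_le hq (Lp.aestronglyMeasurable _)).trans ?_
    exact (hA _).trans (mul_le_mul_right (h j) C)

theorem abs_sub_projIcc_le {r s : ℝ} (hs : s ∈ Set.Icc (-1 : ℝ) 1) :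
    |r - (Set.projIcc (-1 : ℝ) 1 (by norm_num) r : ℝ)| ≤ |r - s| := by
  obtain ⟨h1, h2⟩ := hs
  rw [Set.coe_projIcc]
  rcases le_total r (-1) with h | h
  · rw [min_eq_right (h.trans (by norm_num)), max_eq_left h, abs_le]
    rw [abs_of_nonpos (by linarith : r - s ≤ 0)]
    constructor <;> linarith
  · rcases le_total r 1 with h' | h'
    · rw [min_eq_right h', max_eq_right h, sub_self, abs_zero]
      exact abs_nonneg _
    · rw [min_eq_left h', max_eq_right (by norm_num), abs_le]
      rw [abs_of_nonneg (by linarith : 0 ≤ r - s)]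
      constructor <;> linarith

end Inclusion

/-! ### Constraints on states and their stability under weak limits. -/

theorem continuous_comb_fst {β : Type} (x : Term β →₀ ℝ) :
    Continuous fun z : State β => comb x z.1 :=
  (continuous_comb x).comp continuous_fst

theorem continuous_combImage_snd {β : Type} (x : Term β →₀ ℝ) :
    Continuous fun z : State β => combImage x z.2 :=
  (continuous_combImage x).comp continuous_snd

/-- Distributions of states that satisfy the identities and the norm inequality of the states of
a `P`-operator. -/
structure IsOperatorState {β : Type} (p q C : ℝ≥0∞) (ν : ProbabilityMeasure (State β)) :
    Prop where
  one : ∀ᵐ z ∂(ν : Measure (State β)), (z.1 .one : ℝ) = 1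
  mul : ∀ s t, ∀ᵐ z ∂(ν : Measure (State β)), (z.1 (.mul s t) : ℝ) = z.1 s * z.1 t
  sq : ∀ t, ∀ᵐ z ∂(ν : Measure (State β)), (z.1 (.sq t) : ℝ) = squash (z.2 t)
  eLpNorm_le : ∀ x : Term β →₀ ℝ, eLpNorm (fun z : State β => combImage x z.2) q ν ≤
    C * eLpNorm (fun z : State β => comb x z.1) p ν

section StateLaw

variable {Ω : Type u} [MeasurableSpace Ω] {μ : Measure Ω} [IsProbabilityMeasure μ]
  {β : Type}

theorem isClosed_one : IsClosed {z : State β | (z.1 .one : ℝ) = 1} :=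
  isClosed_eq (by fun_prop) (by fun_prop)

theorem isClosed_mul (s t : Term β) :
    IsClosed {z : State β | (z.1 (.mul s t) : ℝ) = z.1 s * z.1 t} :=
  isClosed_eq (by fun_prop) (by fun_prop)

theorem isClosed_sq (t : Term β) : IsClosed {z : State β | (z.1 (.sq t) : ℝ) = squash (z.2 t)} :=
  isClosed_eq (by fun_prop) (continuous_squash.comp (by fun_prop))

variable [Countable β]

theorem eLpNorm_stateLaw (A : POperator μ) (b : β → UnitFun μ) {h : State β → ℝ}
    (hh : Continuous h) (p : ℝ≥0∞) :
    eLpNorm h p (stateLaw A b : Measure (State β)) = eLpNorm (fun ω => h (stateMap A b ω)) p μ :=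
  eLpNorm_map_measure hh.aestronglyMeasurable (measurable_stateMap A b).aemeasurable

theorem isOperatorState_stateLaw {p q C : ℝ≥0∞} {A : POperator μ}
    (hA : ∀ v, eLpNorm (A v) q μ ≤ C * eLpNorm v p μ) (b : β → UnitFun μ) :
    IsOperatorState p q C (stateLaw A b) where
  one := by
    refine ae_stateLaw (F := {z : State β | (z.1 .one : ℝ) = 1}) ?_ isClosed_one.measurableSet
    filter_upwards [stateMap_fst_ae A b .one,
      UnitFun.coeFn_of (μ := μ) (fun _ => 1) aestronglyMeasurable_const (by simp)] with ω h1 h2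
    rw [h1, eval, h2]
  mul s t := by
    refine ae_stateLaw (F := {z : State β | (z.1 (.mul s t) : ℝ) = z.1 s * z.1 t}) ?_
      (isClosed_mul s t).measurableSet
    filter_upwards [stateMap_fst_ae A b (.mul s t), stateMap_fst_ae A b s, stateMap_fst_ae A b t,
      UnitFun.coeFn_of (μ := μ) ((eval A b s).1 * (eval A b t).1 : Ω → ℝ) _ _] with ω h1 h2 h3 h4
    rw [h1, h2, h3, eval]
    exact h4
  sq t := by
    refine ae_stateLaw (F := {z : State β | (z.1 (.sq t) : ℝ) = squash (z.2 t)}) ?_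
      (isClosed_sq t).measurableSet
    filter_upwards [stateMap_fst_ae A b (.sq t),
      UnitFun.coeFn_of (μ := μ) (fun ω => squash (A (eval A b t).1 ω)) _ _] with ω h1 h2
    rw [h1, eval, h2, stateMap]
  eLpNorm_le x := by
    rw [eLpNorm_stateLaw A b (continuous_combImage_snd x),
      eLpNorm_stateLaw A b (continuous_comb_fst x),
      ← eLpNorm_congr_ae (coeFn_apply_eval_comb A b x), ← eLpNorm_congr_ae (coeFn_eval_comb A b x)]
    exact hA _

theorem tendsto_eLpNorm_fst {νs : ℕ → ProbabilityMeasure (State β)}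
    {ν : ProbabilityMeasure (State β)} (hν : Tendsto νs atTop (𝓝 ν)) {p : ℝ≥0∞}
    (hp : p ≠ 0) (hp' : p ≠ ∞) {h : (Term β → Set.Icc (-1 : ℝ) 1) → ℝ} (hh : Continuous h) :
    Tendsto (fun i => eLpNorm (fun z => h z.1) p (νs i : Measure (State β))) atTop
      (𝓝 (eLpNorm (fun z => h z.1) p (ν : Measure (State β)))) := by
  have h1 := ProbabilityMeasure.tendsto_map_of_tendsto_of_continuous νs ν hν
    (continuous_fst : Continuous (Prod.fst : State β → _))
  have h2 := tendsto_eLpNorm_of_compactSpace h1 hh hp hp'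
  simp only [ProbabilityMeasure.toMeasure_map] at h2
  simpa only [eLpNorm_map_measure hh.aestronglyMeasurable measurable_fst.aemeasurable] using! h2

/-- The identities define closed sets. In the norm inequality the right side converges, as it
depends on the compact first factor only, while the left side is lower semicontinuous. -/
theorem IsOperatorState.of_tendsto {νs : ℕ → ProbabilityMeasure (State β)}
    {ν : ProbabilityMeasure (State β)} (hν : Tendsto νs atTop (𝓝 ν)) {p q C : ℝ≥0∞}
    (hp : p ≠ 0) (hp' : p ≠ ∞) (hq : q ≠ 0) (hC : C ≠ ∞)
    (h : ∀ i, IsOperatorState p q C (νs i)) : IsOperatorState p q C ν where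
  one := ae_mem_of_tendsto_of_isClosed hν isClosed_one (Eventually.of_forall fun i => (h i).one)
  mul s t := ae_mem_of_tendsto_of_isClosed hν (isClosed_mul s t)
    (Eventually.of_forall fun i => (h i).mul s t)
  sq t := ae_mem_of_tendsto_of_isClosed hν (isClosed_sq t)
    (Eventually.of_forall fun i => (h i).sq t)
  eLpNorm_le x := by
    refine eLpNorm_le_of_tendsto hν (continuous_combImage_snd x) hq
      (fun i => (h i).eLpNorm_le x) ?_
    exact ENNReal.Tendsto.const_mul (tendsto_eLpNorm_fst hν hp hp' (continuous_comb x))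
      (Or.inr hC)

end StateLaw

/-! ### Construction of the limit operator. -/

section LimitOperator

variable {β : Type}

/-- The distribution of the first coordinates of a random state. -/
def baseMeasure (ν : ProbabilityMeasure (State β)) : Measure (Term β → Set.Icc (-1 : ℝ) 1) :=
  (ν : Measure (State β)).map Prod.fst

instance (ν : ProbabilityMeasure (State β)) : IsProbabilityMeasure (baseMeasure ν) :=
  Measure.isProbabilityMeasure_map measurable_fst.aemeasurable

/-- Reconstruction of a state from its first coordinates. -/
def lift (y : Term β → Set.Icc (-1 : ℝ) 1) : State β := (y, fun t => unsquash (y (.sq t)))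

theorem measurable_lift : Measurable (lift : _ → State β) :=
  measurable_id.prodMk (measurable_pi_lambda _ fun _ =>
    measurable_unsquash.comp (measurable_subtype_coe.comp (measurable_pi_apply _)))

/-- The random vector of linear combinations of coordinates. -/
def combVector {k : ℕ} (x : Fin k → Term β →₀ ℝ) (z : State β) :
    EuclideanSpace ℝ (Fin k ⊕ Fin k) :=
  WithLp.toLp 2 (Sum.elim (fun j => comb (x j) z.1) (fun j => combImage (x j) z.2))

theorem continuous_combVector {k : ℕ} (x : Fin k → Term β →₀ ℝ) : Continuous (combVector x) := by
  refine (PiLp.continuous_toLp 2 _).comp (continuous_pi ?_)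
  rintro (j | j)
  · exact (continuous_comb (x j)).comp continuous_fst
  · exact (continuous_combImage (x j)).comp continuous_snd

variable [Countable β] {p q C : ℝ≥0∞} {ν : ProbabilityMeasure (State β)}

/-- Each image value is recovered by applying `unsquash` to the coordinate of `.sq t`. Countability
of the terms gives one null set for all `t`. -/
theorem IsOperatorState.lift_fst_ae (h : IsOperatorState p q C ν) :
    ∀ᵐ z ∂(ν : Measure (State β)), lift z.1 = z := by
  filter_upwards [ae_all_iff.2 h.sq] with z hz
  refine Prod.ext rfl (funext fun t => ?_)
  simp only [lift, hz t, unsquash_squash]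

theorem IsOperatorState.map_lift (h : IsOperatorState p q C ν) :
    (baseMeasure ν).map lift = (ν : Measure (State β)) := by
  rw [baseMeasure, Measure.map_map measurable_lift measurable_fst]
  exact (Measure.map_congr h.lift_fst_ae).trans Measure.map_id

theorem IsOperatorState.eLpNorm_lift (h : IsOperatorState p q C ν) {g : State β → ℝ}
    (hg : Continuous g) (r : ℝ≥0∞) :
    eLpNorm (fun y => g (lift y)) r (baseMeasure ν) = eLpNorm g r (ν : Measure (State β)) := by
  rw [← h.map_lift]
  exact (eLpNorm_map_measure hg.aestronglyMeasurable measurable_lift.aemeasurable).symm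

theorem IsOperatorState.ae_baseMeasure (h : IsOperatorState p q C ν) {F : Set (State β)}
    (hF : ∀ᵐ z ∂(ν : Measure (State β)), z ∈ F) : ∀ᵐ y ∂baseMeasure ν, lift y ∈ F := by
  rw [← h.map_lift] at hF
  exact ae_of_ae_map measurable_lift.aemeasurable hF

theorem IsOperatorState.memLp_lift_snd [Fact (1 ≤ q)] (h : IsOperatorState p q C ν) (hC : C ≠ ∞)
    (t : Term β) : MemLp (fun y => (lift y).2 t) 1 (baseMeasure ν) := by
  refine MemLp.mono_exponent (q := q) ⟨?_, ?_⟩ Fact.out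
  · exact ((measurable_pi_apply t).comp (measurable_snd.comp measurable_lift)).aestronglyMeasurable
  · have h1 := h.eLpNorm_le (Finsupp.single t 1)
    have h2 : (fun z : State β => combImage (Finsupp.single t 1) z.2) = fun z => z.2 t := by
      funext z
      simp [combImage]
    rw [h2, ← h.eLpNorm_lift (by fun_prop)] at h1
    refine h1.trans_lt (ENNReal.mul_lt_top hC.lt_top ?_)
    have h3 : (fun z : State β => comb (Finsupp.single t 1) z.1) = fun z => (z.1 t : ℝ) := by
      funext z
      simp [comb]
    rw [h3]
    refine (eLpNorm_le_of_ae_bound (C := 1) (Eventually.of_forall fun z => ?_)).trans_lt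
      (by simp)
    exact abs_le.2 (z.1 t).2

/-- The coordinate functions on the space of first coordinates. -/
def coord (t : Term β) : C(Term β → Set.Icc (-1 : ℝ) 1, ℝ) := ⟨fun y => y t, by fun_prop⟩

/-- The coordinate functions as elements of `L^∞`. -/
def coordUnit (ν : ProbabilityMeasure (State β)) (t : Term β) : UnitFun (baseMeasure ν) :=
  UnitFun.of (coord t) (coord t).continuous.aestronglyMeasurable
    (Eventually.of_forall fun y => (y t).2)

theorem coeFn_coordUnit_comb (x : Term β →₀ ℝ) :
    ⇑(Finsupp.linearCombination ℝ (fun t => (coordUnit ν t).1) x) =ᵐ[baseMeasure ν] comb x := by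
  refine (coeFn_linearCombination _ x).trans ?_
  have h : ∀ᵐ y ∂baseMeasure ν, ∀ t ∈ x.support, (coordUnit ν t).1 y = y t := by
    rw [Finset.eventually_all]
    exact fun t _ => UnitFun.coeFn_of _ _ _
  filter_upwards [h] with y hy
  exact Finset.sum_congr rfl fun t ht => by simp only [hy t ht]

variable [Fact (1 ≤ p)]

/-- Linear combinations of coordinate functions, as elements of `L^p`. -/
def combLp (p : ℝ≥0∞) [Fact (1 ≤ p)] (ν : ProbabilityMeasure (State β)) :
    (Term β →₀ ℝ) →ₗ[ℝ] Lp ℝ p (baseMeasure ν) :=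
  (inclusionLp (baseMeasure ν) p).toLinearMap ∘ₗ
    Finsupp.linearCombination ℝ (fun t => (coordUnit ν t).1)

theorem coeFn_combLp (x : Term β →₀ ℝ) : ⇑(combLp p ν x) =ᵐ[baseMeasure ν] comb x :=
  coeFn_coordUnit_comb x

/-- The coordinates separate points, so their algebra is uniformly dense in the continuous
functions, which are dense in `L^p` for `p < ∞`. The constraints `one` and `mul` make every monomial
almost everywhere a single coordinate, so this algebra adds nothing to the linear span. -/
theorem IsOperatorState.denseRange_combLp (h : IsOperatorState p q C ν) (hp : p ≠ ∞) :
    DenseRange (combLp p ν) := by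
  let S : Subalgebra ℝ C(Term β → Set.Icc (-1 : ℝ) 1, ℝ) := Algebra.adjoin ℝ (Set.range coord)
  have hS : S.topologicalClosure = ⊤ := by
    refine ContinuousMap.subalgebra_topologicalClosure_eq_top_of_separatesPoints S ?_
    intro y y' hy
    obtain ⟨t, ht⟩ := Function.ne_iff.1 hy
    exact ⟨coord t, ⟨coord t, Algebra.subset_adjoin ⟨t, rfl⟩, rfl⟩,
      fun h' => ht (Subtype.ext h')⟩
  have hmono : ∀ m ∈ Submonoid.closure (Set.range (coord (β := β))),
      ∃ t : Term β, ⇑m =ᵐ[baseMeasure ν] coord t := by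
    intro m hm
    induction hm using Submonoid.closure_induction with
    | mem m hm =>
      obtain ⟨t, rfl⟩ := hm
      exact ⟨t, Eventually.of_forall fun _ => rfl⟩
    | one =>
      refine ⟨.one, ?_⟩
      filter_upwards [h.ae_baseMeasure (F := {z | (z.1 .one : ℝ) = 1}) h.one] with y hy
      exact hy.symm
    | mul m n _ _ hm hn =>
      obtain ⟨s, hs⟩ := hm
      obtain ⟨t, ht⟩ := hn
      refine ⟨.mul s t, ?_⟩
      filter_upwards [hs, ht,
        h.ae_baseMeasure (F := {z | (z.1 (.mul s t) : ℝ) = z.1 s * z.1 t}) (h.mul s t)]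
        with y h1 h2 h3
      rw [ContinuousMap.mul_apply, h1, h2]
      exact h3.symm
  let T := ContinuousMap.toLp (E := ℝ) p (baseMeasure ν) ℝ
  have hrange : ∀ f ∈ S, T f ∈ LinearMap.range (combLp p ν) := by
    intro f hf
    have hf' : f ∈ Submodule.span ℝ
        (Submonoid.closure (Set.range (coord (β := β))) : Set C(_, ℝ)) := by
      rw [← Algebra.adjoin_eq_span]
      exact hf
    refine Submodule.span_le (p := (LinearMap.range (combLp p ν)).comap T.toLinearMap).2 ?_ hf'
    intro m hm
    obtain ⟨t, ht⟩ := hmono m hm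
    refine ⟨Finsupp.single t 1, Lp.ext ?_⟩
    filter_upwards [coeFn_combLp (p := p) (ν := ν) (Finsupp.single t 1),
      ContinuousMap.coeFn_toLp (p := p) (𝕜 := ℝ) (baseMeasure ν) m, ht] with y h1 h2 h3
    refine h1.trans (Eq.trans ?_ (h2.trans h3).symm)
    simp [comb, coord]
  have hT : DenseRange T := ContinuousMap.toLp_denseRange ℝ (baseMeasure ν) ℝ hp
  have hS' : Dense (S : Set C(Term β → Set.Icc (-1 : ℝ) 1, ℝ)) := by
    rw [dense_iff_closure_eq, ← Subalgebra.topologicalClosure_coe, hS]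
    rfl
  refine (hT.dense_image T.continuous hS').mono ?_
  rintro _ ⟨f, hf, rfl⟩
  exact hrange f hf

variable [Fact (1 ≤ q)]

/-- The images of linear combinations of coordinate functions. -/
def IsOperatorState.imageLp (h : IsOperatorState p q C ν) (hC : C ≠ ∞) :
    (Term β →₀ ℝ) →ₗ[ℝ] Lp ℝ 1 (baseMeasure ν) :=
  Finsupp.linearCombination ℝ (fun t => (h.memLp_lift_snd hC t).toLp _)

omit [Fact (1 ≤ p)] in
theorem IsOperatorState.coeFn_imageLp (h : IsOperatorState p q C ν) (hC : C ≠ ∞)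
    (x : Term β →₀ ℝ) :
    ⇑(h.imageLp hC x) =ᵐ[baseMeasure ν] fun y => combImage x (lift y).2 := by
  refine (coeFn_linearCombination _ x).trans ?_
  have h : ∀ᵐ y ∂baseMeasure ν, ∀ t ∈ x.support,
      (h.memLp_lift_snd hC t).toLp _ y = (lift y).2 t := by
    rw [Finset.eventually_all]
    exact fun t _ => MemLp.coeFn_toLp _
  filter_upwards [h] with y hy
  exact Finset.sum_congr rfl fun t ht => by simp only [hy t ht]

theorem IsOperatorState.eLpNorm_imageLp_le (h : IsOperatorState p q C ν) (hC : C ≠ ∞)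
    (x : Term β →₀ ℝ) :
    eLpNorm (h.imageLp hC x) q (baseMeasure ν) ≤ C * eLpNorm (combLp p ν x) p (baseMeasure ν) := by
  rw [eLpNorm_congr_ae (h.coeFn_imageLp hC x), eLpNorm_congr_ae (coeFn_combLp x)]
  have h1 := h.eLpNorm_le x
  rw [← h.eLpNorm_lift (continuous_combImage_snd x),
    ← h.eLpNorm_lift (continuous_comb_fst x)] at h1
  exact h1

theorem IsOperatorState.norm_imageLp_le (h : IsOperatorState p q C ν) (hC : C ≠ ∞)
    (x : Term β →₀ ℝ) : ‖h.imageLp hC x‖ ≤ C.toReal * ‖combLp p ν x‖ := by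
  rw [Lp.norm_def, Lp.norm_def, ← ENNReal.toReal_mul]
  refine ENNReal.toReal_mono (ENNReal.mul_ne_top hC (Lp.eLpNorm_ne_top _)) ?_
  refine le_trans ?_ (h.eLpNorm_imageLp_le hC x)
  exact eLpNorm_le_eLpNorm_of_exponent_le Fact.out (Lp.aestronglyMeasurable _)

/-- The operator on the space of first coordinates that maps the coordinate functions to their
images. -/
def IsOperatorState.extend (h : IsOperatorState p q C ν) (hC : C ≠ ∞) :
    Lp ℝ p (baseMeasure ν) →L[ℝ] Lp ℝ 1 (baseMeasure ν) :=
  (h.imageLp hC).extendOfNorm (combLp p ν)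

theorem IsOperatorState.extend_combLp (h : IsOperatorState p q C ν) (hp : p ≠ ∞) (hC : C ≠ ∞)
    (x : Term β →₀ ℝ) : h.extend hC (combLp p ν x) = h.imageLp hC x :=
  LinearMap.extendOfNorm_eq (h.denseRange_combLp hp) ⟨C.toReal, h.norm_imageLp_le hC⟩ x

/-- The extension is continuous only into `L^1`. The `L^q` bound is recovered from an almost
everywhere convergent subsequence of the images and Fatou's lemma. -/
theorem IsOperatorState.eLpNorm_extend_le (h : IsOperatorState p q C ν) (hp : p ≠ ∞) (hC : C ≠ ∞)
    (w : Lp ℝ p (baseMeasure ν)) :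
    eLpNorm (h.extend hC w) q (baseMeasure ν) ≤ C * eLpNorm w p (baseMeasure ν) := by
  obtain ⟨y, hy, hlim⟩ := mem_closure_iff_seq_limit.1 (h.denseRange_combLp hp w)
  choose x hx using hy
  have h1 : Tendsto (fun n => h.imageLp hC (x n)) atTop (𝓝 (h.extend hC w)) := by
    have := ((h.extend hC).continuous.tendsto w).comp hlim
    refine this.congr fun n => ?_
    rw [Function.comp_apply, ← hx n, h.extend_combLp hp hC]
  obtain ⟨φ, hφ, hae⟩ := (tendstoInMeasure_of_tendsto_Lp h1).exists_seq_tendsto_ae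
  refine (Lp.eLpNorm_lim_le_liminf_eLpNorm (fun n => Lp.aestronglyMeasurable _) _ hae).trans ?_
  have h2 : Tendsto (fun n => C * eLpNorm (y (φ n)) p (baseMeasure ν)) atTop
      (𝓝 (C * eLpNorm w p (baseMeasure ν))) := by
    refine ENNReal.Tendsto.const_mul ?_ (Or.inr hC)
    have h3 := (hlim.comp hφ.tendsto_atTop).enorm
    simpa only [Lp.enorm_def] using! h3
  rw [← h2.liminf_eq]
  refine liminf_le_liminf (Eventually.of_forall fun n => ?_)
  rw [← hx]
  exact h.eLpNorm_imageLp_le hC _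

/-- The `P`-operator that belongs to a distribution of states. -/
def IsOperatorState.operator (h : IsOperatorState p q C ν) (hC : C ≠ ∞) :
    POperator (baseMeasure ν) :=
  (h.extend hC).comp (inclusionLp (baseMeasure ν) p)

theorem IsOperatorState.eLpNorm_operator_le (h : IsOperatorState p q C ν) (hp : p ≠ ∞)
    (hC : C ≠ ∞) (v : Lp ℝ ∞ (baseMeasure ν)) :
    eLpNorm (h.operator hC v) q (baseMeasure ν) ≤ C * eLpNorm v p (baseMeasure ν) :=
  h.eLpNorm_extend_le hp hC (inclusionLp (baseMeasure ν) p v)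

theorem IsOperatorState.opNorm_operator_le (h : IsOperatorState p q C ν) (hp : p ≠ ∞)
    (hC : C ≠ ∞) : opNorm p q (h.operator hC) ≤ C :=
  iSup_le fun v => ENNReal.div_le_of_le_mul (h.eLpNorm_operator_le hp hC v)

/-- Used for the given operators with `f = stateMap A b` and for the limit with `f = lift`: both
joint laws are pushed forward by the same continuous map, so weak convergence of states carries
over. -/
theorem jointLaw_eq_map {Ω : Type u} [MeasurableSpace Ω] {μ : Measure Ω} [IsProbabilityMeasure μ]
    (A : POperator μ) {k : ℕ} (v : Fin k → Lp ℝ ∞ μ) (x : Fin k → Term β →₀ ℝ) {f : Ω → State β}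
    (hf : Measurable f) {η : ProbabilityMeasure (State β)} (hη : μ.map f = η)
    (hv : ∀ j, v j =ᵐ[μ] fun ω => comb (x j) (f ω).1)
    (hAv : ∀ j, A (v j) =ᵐ[μ] fun ω => combImage (x j) (f ω).2) :
    jointLaw A v = LevyProkhorov.ofMeasure
      (η.map (continuous_combVector x).measurable.aemeasurable) := by
  refine congrArg LevyProkhorov.ofMeasure (Subtype.ext ?_)
  change μ.map (jointVector A v) = (η : Measure (State β)).map (combVector x)
  rw [← hη, Measure.map_map (continuous_combVector x).measurable hf]
  refine Measure.map_congr ?_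
  filter_upwards [ae_all_iff.2 hv, ae_all_iff.2 hAv] with ω h1 h2
  simp only [jointVector, combVector, Function.comp_apply, h1, h2]

theorem jointLaw_eval_comb {Ω : Type u} [MeasurableSpace Ω] {μ : Measure Ω}
    [IsProbabilityMeasure μ] (A : POperator μ) (b : β → UnitFun μ) {k : ℕ}
    (x : Fin k → Term β →₀ ℝ) :
    jointLaw A (fun j => Finsupp.linearCombination ℝ (fun t => (eval A b t).1) (x j)) =
      LevyProkhorov.ofMeasure
        ((stateLaw A b).map (continuous_combVector x).measurable.aemeasurable) :=
  jointLaw_eq_map A _ x (measurable_stateMap A b) rfl (fun j => coeFn_eval_comb A b (x j))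
    fun j => coeFn_apply_eval_comb A b (x j)

theorem IsOperatorState.jointLaw_operator_comb (h : IsOperatorState p q C ν) (hp : p ≠ ∞)
    (hC : C ≠ ∞) {k : ℕ} (x : Fin k → Term β →₀ ℝ) :
    jointLaw (h.operator hC)
        (fun j => Finsupp.linearCombination ℝ (fun t => (coordUnit ν t).1) (x j)) =
      LevyProkhorov.ofMeasure (ν.map (continuous_combVector x).measurable.aemeasurable) := by
  refine jointLaw_eq_map _ _ x measurable_lift h.map_lift
    (fun j => coeFn_coordUnit_comb (x j)) fun j => ?_
  have h1 : h.operator hC (Finsupp.linearCombination ℝ (fun t => (coordUnit ν t).1) (x j)) =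
      h.imageLp hC (x j) := h.extend_combLp hp hC (x j)
  rw [h1]
  exact h.coeFn_imageLp hC (x j)

end LimitOperator

/-! ### Comparison of profiles along the subsequence. -/

section Limit

variable {β : Type} [Countable β] {p q C : ℝ≥0∞} [Fact (1 ≤ p)] [Fact (1 ≤ q)]
  {ν : ProbabilityMeasure (State β)}
  {Ω : ℕ → Type u} [∀ i, MeasurableSpace (Ω i)] {μ : ∀ i, Measure (Ω i)}
  [∀ i, IsProbabilityMeasure (μ i)] {A : ∀ i, POperator (μ i)} {b : ∀ i, β → UnitFun (μ i)}

theorem IsOperatorState.tendsto_jointLaw_comb (h : IsOperatorState p q C ν) (hp : p ≠ ∞)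
    (hC : C ≠ ∞) (hν : Tendsto (fun i => stateLaw (A i) (b i)) atTop (𝓝 ν)) {k : ℕ}
    (x : Fin k → Term β →₀ ℝ) :
    Tendsto (fun i => jointLaw (A i)
        (fun j => Finsupp.linearCombination ℝ (fun t => (eval (A i) (b i) t).1) (x j))) atTop
      (𝓝 (jointLaw (h.operator hC)
        (fun j => Finsupp.linearCombination ℝ (fun t => (coordUnit ν t).1) (x j)))) := by
  simp only [jointLaw_eval_comb, h.jointLaw_operator_comb hp hC]
  exact (LevyProkhorov.continuous_ofMeasure_probabilityMeasure.tendsto _).comp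
    (ProbabilityMeasure.tendsto_map_of_tendsto_of_continuous _ ν hν (continuous_combVector x))

theorem IsOperatorState.exists_mem_profile_tendsto (h : IsOperatorState p q C ν) (hp : p ≠ ∞)
    (hC : C ≠ ∞) (hν : Tendsto (fun i => stateLaw (A i) (b i)) atTop (𝓝 ν)) {k : ℕ}
    (s : Fin k → β) :
    ∃ τ ∈ profile (h.operator hC) k,
      Tendsto (fun i => jointLaw (A i) fun j => (b i (s j)).1) atTop (𝓝 τ) := by
  have h1 := h.tendsto_jointLaw_comb hp hC hν (fun j => Finsupp.single (Term.base (s j)) 1)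
  simp only [Finsupp.linearCombination_single, one_smul, eval] at h1
  exact ⟨_, ⟨_, fun j => (coordUnit ν _).2, rfl⟩, h1⟩

theorem exists_pos_mul_le (k : ℕ) (hC : C ≠ ∞) {ε : ℝ≥0∞} (hε : ε ≠ 0) :
    ∃ δ : ℝ≥0∞, 0 < δ ∧ k * (δ + C * δ) ≤ ε * ε := by
  have h1 : Tendsto (fun δ : ℝ≥0∞ => k * (δ + C * δ)) (𝓝 0) (𝓝 (k * (0 + C * 0))) :=
    ENNReal.Tendsto.const_mul (tendsto_id.add (ENNReal.Tendsto.const_mul tendsto_id (Or.inr hC)))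
      (Or.inr (ENNReal.natCast_ne_top k))
  have h2 : k * (0 + C * 0) < ε * ε := by
    simpa using ENNReal.mul_pos hε hε
  obtain ⟨δ, hδ, hδ'⟩ := ((h1.eventually (gt_mem_nhds h2)).filter_mono nhdsWithin_le_nhds
    |>.and (self_mem_nhdsWithin : Set.Ioi (0 : ℝ≥0∞) ∈ 𝓝[>] 0)).exists
  exact ⟨δ, hδ', hδ.le⟩

-- Expresses the truncation error through a continuous function of the first coordinates, whose
-- `L^p` norm converges with the state laws.
omit [Fact (1 ≤ p)] in
theorem eLpNorm_sub_clamp_comb {Ω : Type u} [MeasurableSpace Ω] {μ : Measure Ω}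
    [IsProbabilityMeasure μ] (A : POperator μ) (b : β → UnitFun μ) (x : Term β →₀ ℝ) :
    eLpNorm (Finsupp.linearCombination ℝ (fun t => (eval A b t).1) x -
      (UnitFun.clamp (Finsupp.linearCombination ℝ (fun t => (eval A b t).1) x)).1 : Lp ℝ ∞ μ) p μ =
    eLpNorm (fun z : State β => comb x z.1 -
      (Set.projIcc (-1 : ℝ) 1 (by norm_num) (comb x z.1) : ℝ)) p (stateLaw A b) := by
  have hcont : Continuous fun z : State β => comb x z.1 -
      (Set.projIcc (-1 : ℝ) 1 (by norm_num) (comb x z.1) : ℝ) :=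
    (continuous_comb_fst x).sub
      (continuous_subtype_val.comp (continuous_projIcc.comp (continuous_comb_fst x)))
  rw [eLpNorm_stateLaw A b hcont]
  refine eLpNorm_congr_ae ?_
  filter_upwards [Lp.coeFn_sub (Finsupp.linearCombination ℝ (fun t => (eval A b t).1) x)
      (UnitFun.clamp (Finsupp.linearCombination ℝ (fun t => (eval A b t).1) x)).1,
    UnitFun.coeFn_of (μ := μ) (fun ω => (Set.projIcc (-1 : ℝ) 1 (by norm_num)
      (Finsupp.linearCombination ℝ (fun t => (eval A b t).1) x ω) : ℝ)) _ _,
    coeFn_eval_comb A b x] with ω h1 h2 h3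
  rw [h1, Pi.sub_apply, UnitFun.clamp, h2, h3]

omit [Fact (1 ≤ q)] in
theorem IsOperatorState.exists_eLpNorm_sub_comb_lt (h : IsOperatorState p q C ν) (hp : p ≠ ∞)
    (v : Lp ℝ ∞ (baseMeasure ν)) {δ : ℝ≥0∞} (hδ : 0 < δ) :
    ∃ x : Term β →₀ ℝ, eLpNorm (v - Finsupp.linearCombination ℝ (fun t => (coordUnit ν t).1) x :
      Lp ℝ ∞ (baseMeasure ν)) p (baseMeasure ν) < δ := by
  obtain ⟨_, ⟨x, rfl⟩, hy⟩ := EMetric.mem_closure_iff.1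
    (h.denseRange_combLp hp (inclusionLp (baseMeasure ν) p v)) δ hδ
  refine ⟨x, ?_⟩
  rw [edist_eq_enorm_sub, Lp.enorm_def] at hy
  exact hy

theorem IsOperatorState.eventually_exists_mem_profile (h : IsOperatorState p q C ν) (hp : p ≠ ∞)
    (hC : C ≠ ∞) (hν : Tendsto (fun i => stateLaw (A i) (b i)) atTop (𝓝 ν))
    (hA : ∀ i v, eLpNorm (A i v) q (μ i) ≤ C * eLpNorm v p (μ i)) {k : ℕ}
    {τ : LevyProkhorov (ProbabilityMeasure (EuclideanSpace ℝ (Fin k ⊕ Fin k)))}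
    (hτ : τ ∈ profile (h.operator hC) k) {ε : ℝ≥0∞} (hε : ε ≠ 0) :
    ∀ᶠ i in atTop, ∃ η ∈ profile (A i) k, edist τ η ≤ ε := by
  -- For `ε = ∞` any element of the profile will do; the case `ε = 1` supplies one.
  wlog hε' : ε ≠ ∞ generalizing ε
  · filter_upwards [this one_ne_zero ENNReal.one_ne_top] with i ⟨η, hη, _⟩
    exact ⟨η, hη, by simp [not_not.1 hε']⟩
  have hp1 : 1 ≤ p := Fact.out
  have hq1 : 1 ≤ q := Fact.out
  obtain ⟨v, hv, rfl⟩ := hτ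
  have hε3 : ε / 3 ≠ 0 := by simp [hε]
  have hε3' : ε / 3 ≠ ∞ := ENNReal.div_ne_top hε' (by norm_num)
  obtain ⟨δ, hδ, hδ'⟩ := exists_pos_mul_le k hC hε3
  choose x hx using fun j => h.exists_eLpNorm_sub_comb_lt hp (v j) hδ
  have h1 : edist (jointLaw (h.operator hC) v) (jointLaw (h.operator hC)
      (fun j => Finsupp.linearCombination ℝ (fun t => (coordUnit ν t).1) (x j))) ≤ ε / 3 :=
    edist_jointLaw_le_of_eLpNorm_le hp1 hq1 (h.eLpNorm_operator_le hp hC) hε3 hε3' hδ'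
      fun j => (hx j).le
  have h2 : ∀ᶠ i in atTop, edist (jointLaw (h.operator hC)
      (fun j => Finsupp.linearCombination ℝ (fun t => (coordUnit ν t).1) (x j)))
      (jointLaw (A i)
        (fun j => Finsupp.linearCombination ℝ (fun t => (eval (A i) (b i) t).1) (x j)))
      < ε / 3 := by
    filter_upwards [(h.tendsto_jointLaw_comb hp hC hν x).eventually
      (Metric.eball_mem_nhds _ (pos_iff_ne_zero.2 hε3))] with i hi
    rwa [edist_comm]
  -- The combinations may leave `[-1, 1]`. In the limit their truncation error is at most the
  -- distance to `v j`, as clamping gives the nearest point of `[-1, 1]` and `v j` takes values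
  -- there; so it is eventually below `δ`.
  have h3 : ∀ᶠ i in atTop, ∀ j, eLpNorm
      (Finsupp.linearCombination ℝ (fun t => (eval (A i) (b i) t).1) (x j) -
      (UnitFun.clamp (Finsupp.linearCombination ℝ (fun t => (eval (A i) (b i) t).1) (x j))).1 :
        Lp ℝ ∞ (μ i)) p (μ i) < δ := by
    refine eventually_all.2 fun j => ?_
    simp only [eLpNorm_sub_clamp_comb]
    have hcont : Continuous fun y => comb (x j) y -
        (Set.projIcc (-1 : ℝ) 1 (by norm_num) (comb (x j) y) : ℝ) :=
      (continuous_comb (x j)).sub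
        (continuous_subtype_val.comp (continuous_projIcc.comp (continuous_comb (x j))))
    refine (tendsto_eLpNorm_fst hν (by positivity) hp hcont).eventually (gt_mem_nhds ?_)
    refine lt_of_le_of_lt ?_ (hx j)
    refine (eLpNorm_map_measure (μ := (ν : Measure (State β))) (f := Prod.fst)
      hcont.aestronglyMeasurable measurable_fst.aemeasurable).symm.trans_le ?_
    refine eLpNorm_mono_ae (μ := baseMeasure ν) ?_
    filter_upwards [Lp.coeFn_sub (v j) (Finsupp.linearCombination ℝ
      (fun t => (coordUnit ν t).1) (x j)), hv j, coeFn_coordUnit_comb (ν := ν) (x j)] with y h1 h2 h3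
    rw [h1, Pi.sub_apply, h3, norm_sub_rev (v j y)]
    exact abs_sub_projIcc_le h2
  filter_upwards [h2, h3] with i h2 h3
  refine ⟨_, ⟨_, fun j => (UnitFun.clamp (Finsupp.linearCombination ℝ
    (fun t => (eval (A i) (b i) t).1) (x j))).2, rfl⟩, ?_⟩
  have h4 := edist_jointLaw_le_of_eLpNorm_le hp1 hq1 (hA i) hε3 hε3' hδ' fun j => (h3 j).le
  calc _ ≤ _ := edist_triangle4 _ _ _ _
    _ ≤ ε / 3 + ε / 3 + ε / 3 := add_le_add (add_le_add h1 h2.le) h4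
    _ = ε := ENNReal.add_thirds ε

end Limit

/-! ### Profiles as sets in a metric space, and the choice of generators. -/

theorem profile_nonempty {Ω : Type u} [MeasurableSpace Ω] {μ : Measure Ω} [IsProbabilityMeasure μ]
    (A : POperator μ) (k : ℕ) : (profile A k).Nonempty := by
  refine ⟨jointLaw A fun _ => 0, fun _ => 0, fun _ => ?_, rfl⟩
  filter_upwards [Lp.coeFn_zero ℝ ∞ μ] with ω h
  rw [h]
  simp

theorem exists_seq_dense_profile {Ω : Type u} [MeasurableSpace Ω] {μ : Measure Ω}
    [IsProbabilityMeasure μ] (A : POperator μ) (k : ℕ) :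
    ∃ η : ℕ → LevyProkhorov (ProbabilityMeasure (EuclideanSpace ℝ (Fin k ⊕ Fin k))),
      (∀ n, η n ∈ profile A k) ∧
      ∀ τ ∈ profile A k, ∀ ε : ℝ≥0∞, 0 < ε → ∃ n, edist τ (η n) < ε := by
  have := (profile_nonempty A k).to_subtype
  have := (isSeparable_profile A k).separableSpace
  refine ⟨fun n => (TopologicalSpace.denseSeq (profile A k) n).1, fun n => Subtype.prop _, ?_⟩
  intro τ hτ ε hε
  obtain ⟨_, ⟨n, rfl⟩, hn⟩ := EMetric.mem_closure_iff.1
    (TopologicalSpace.denseRange_denseSeq (profile A k) ⟨τ, hτ⟩) ε hε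
  exact ⟨n, hn⟩

theorem hausdorffEDist_profile_le_one {Ω : Type u} [MeasurableSpace Ω] {μ : Measure Ω}
    [IsProbabilityMeasure μ] {Ω' : Type v} [MeasurableSpace Ω'] {μ' : Measure Ω'}
    [IsProbabilityMeasure μ'] (A : POperator μ) (B : POperator μ') (k : ℕ) :
    Metric.hausdorffEDist (profile A k) (profile B k) ≤ 1 := by
  have h1 : ∀ η τ : LevyProkhorov (ProbabilityMeasure (EuclideanSpace ℝ (Fin k ⊕ Fin k))),
      edist η τ ≤ 1 := fun η τ => by
    rw [LevyProkhorov.edist_probabilityMeasure_def]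
    refine (levyProkhorovEDist_le_max_measure_univ _ _).trans ?_
    simp
  obtain ⟨a, ha⟩ := profile_nonempty A k
  obtain ⟨c, hc⟩ := profile_nonempty B k
  exact Metric.hausdorffEDist_le_of_mem_edist (fun η _ => ⟨c, hc, h1 _ _⟩)
    fun η _ => ⟨a, ha, h1 _ _⟩

/-- Dominated convergence for counting measure: each Hausdorff distance is at most `1`, so the
summable weights dominate. -/
theorem tendsto_dM {Ω : ℕ → Type u} [∀ i, MeasurableSpace (Ω i)] {μ : ∀ i, Measure (Ω i)}
    [∀ i, IsProbabilityMeasure (μ i)] {A : ∀ i, POperator (μ i)}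
    {Ω' : Type v} [MeasurableSpace Ω'] {μ' : Measure Ω'} [IsProbabilityMeasure μ']
    {B : POperator μ'}
    (h : ∀ k, Tendsto (fun i => Metric.hausdorffEDist (profile (A i) k) (profile B k)) atTop
      (𝓝 0)) : Tendsto (fun i => dM (A i) B) atTop (𝓝 0) := by
  have hsum : ∑' k : ℕ, (2⁻¹ : ℝ≥0∞) ^ (k + 1) ≠ ∞ := by
    simp [pow_succ, ENNReal.tsum_mul_right, ENNReal.tsum_geometric]
  have h1 : Tendsto (fun i => ∫⁻ k : ℕ, (2⁻¹ : ℝ≥0∞) ^ (k + 1) *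
      Metric.hausdorffEDist (profile (A i) (k + 1)) (profile B (k + 1)) ∂Measure.count) atTop
      (𝓝 (∫⁻ _ : ℕ, 0 ∂Measure.count)) := by
    refine tendsto_lintegral_of_dominated_convergence (fun k => (2⁻¹ : ℝ≥0∞) ^ (k + 1))
      (fun i => measurable_of_countable _) (fun i => Eventually.of_forall fun k => ?_) ?_
      (Eventually.of_forall fun k => ?_)
    · exact mul_le_of_le_one_right' (hausdorffEDist_profile_le_one _ _ _)
    · rwa [lintegral_count]
    · have := ENNReal.Tendsto.const_mul (a := (2⁻¹ : ℝ≥0∞) ^ (k + 1)) (h (k + 1))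
        (Or.inr (ENNReal.pow_ne_top (by simp)))
      rwa [mul_zero] at this
  simpa only [dM, lintegral_count, tsum_zero] using h1

section Matching

variable {Ω : ℕ → Type u} [∀ i, MeasurableSpace (Ω i)] {μ : ∀ i, Measure (Ω i)}
  [∀ i, IsProbabilityMeasure (μ i)]

/-- There are countably many tuples of functions, given on all the spaces simultaneously, whose
joint laws approximate all elements of all the profiles. -/
theorem exists_matching (A : ∀ i, POperator (μ i)) :
    ∃ b : ∀ i, (Σ k : ℕ, ℕ × ℕ × Fin k) → UnitFun (μ i), ∀ k m,
      ∀ τ ∈ profile (A m) k, ∀ ε : ℝ≥0∞, 0 < ε → ∃ n, ∀ i,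
        edist τ (jointLaw (A i) fun j => (b i ⟨k, m, n, j⟩).1) ≤
          ε + (Metric.hausdorffEDist (profile (A m) k) (profile (A i) k) + (i + 1 : ℝ≥0∞)⁻¹) := by
  choose η hη hdense using fun m k => exists_seq_dense_profile (A m) k
  have h1 : ∀ i k m n, ∃ v : Fin k → UnitFun (μ i),
      edist (η m k n) (jointLaw (A i) fun j => (v j).1) <
        Metric.hausdorffEDist (profile (A m) k) (profile (A i) k) + (i + 1 : ℝ≥0∞)⁻¹ := by
    -- The infimum in the Hausdorff distance need not be attained; the slack `1 / (i + 1)` makes a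
    -- choice possible and vanishes along the sequence.
    intro i k m n
    have h2 : Metric.hausdorffEDist (profile (A m) k) (profile (A i) k) <
        Metric.hausdorffEDist (profile (A m) k) (profile (A i) k) + (i + 1 : ℝ≥0∞)⁻¹ := by
      refine ENNReal.lt_add_right ?_ (ENNReal.inv_ne_zero.2 (by finiteness))
      exact ((hausdorffEDist_profile_le_one _ _ _).trans_lt ENNReal.one_lt_top).ne
    obtain ⟨_, ⟨v, hv, rfl⟩, hlt⟩ :=
      Metric.exists_edist_lt_of_hausdorffEDist_lt (hη m k n) h2
    exact ⟨fun j => ⟨v j, hv j⟩, hlt⟩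
  choose v hv using h1
  refine ⟨fun i s => v i s.1 s.2.1 s.2.2.1 s.2.2.2, fun k m τ hτ ε hε => ?_⟩
  obtain ⟨n, hn⟩ := hdense m k τ hτ ε hε
  exact ⟨n, fun i => (edist_triangle _ _ _).trans (add_le_add hn.le (hv i k m n).le)⟩

end Matching

/-! ### Existence of the limit object. -/

theorem exists_limit_operator {p q : ℝ≥0∞} (hp : 1 ≤ p) (hp' : p ≠ ∞) (hq : 1 ≤ q)
    {Ω : ℕ → Type u} [∀ i, MeasurableSpace (Ω i)] {μ : ∀ i, Measure (Ω i)}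
    [∀ i, IsProbabilityMeasure (μ i)] (A : ∀ i, POperator (μ i)) (hconv : ActionConvergent A)
    {C : ℝ≥0∞} (hC : C ≠ ∞) (hAC : ∀ i, opNorm p q (A i) ≤ C) :
    ∃ (Ω' : Type) (_ : MeasurableSpace Ω') (κ : Measure Ω') (_ : IsProbabilityMeasure κ)
      (B : POperator κ), Tendsto (fun i => dM (A i) B) atTop (𝓝 0) ∧ opNorm p q B ≤ C := by
  have : Fact (1 ≤ p) := ⟨hp⟩
  have : Fact (1 ≤ q) := ⟨hq⟩
  have hp0 : p ≠ 0 := (zero_lt_one.trans_le hp).ne'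
  have hq0 : q ≠ 0 := (zero_lt_one.trans_le hq).ne'
  have hA : ∀ i v, eLpNorm (A i v) q (μ i) ≤ C * eLpNorm v p (μ i) := fun i v =>
    (eLpNorm_apply_le_opNorm_mul hp0 (A i) v).trans (mul_le_mul_left (hAC i) _)
  have hA1 : ∀ i, ∀ v : UnitFun (μ i), eLpNorm (A i v.1) 1 (μ i) ≤ C := fun i v =>
    calc eLpNorm (A i v.1) 1 (μ i) ≤ eLpNorm (A i v.1) q (μ i) :=
          eLpNorm_le_eLpNorm_of_exponent_le hq (Lp.aestronglyMeasurable _)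
      _ ≤ C * eLpNorm v.1 p (μ i) := hA i _
      _ ≤ C := mul_le_of_le_one_right' (v.eLpNorm_le_one p)
  obtain ⟨b, hb⟩ := exists_matching A
  obtain ⟨ν, -, φ, hφ, hν⟩ := (isCompact_closure_of_isTightMeasureSet
    (isTightMeasureSet_stateLaw A b hC hA1)).tendsto_subseq
    fun i => subset_closure (Set.mem_range_self i)
  have hν' : Tendsto (fun i => stateLaw (A (φ i)) (b (φ i))) atTop (𝓝 ν) := hν
  have h : IsOperatorState p q C ν := IsOperatorState.of_tendsto hν' hp0 hp' hq0 hC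
    fun i => isOperatorState_stateLaw (hA (φ i)) _
  refine ⟨_, _, baseMeasure ν, inferInstance, h.operator hC, tendsto_dM fun k => ?_,
    h.opNorm_operator_le hp' hC⟩
  refine ENNReal.tendsto_nhds_zero.2 fun ε hε => ?_
  have hε3 : 0 < ε / 3 := ENNReal.div_pos hε.ne' (by norm_num)
  obtain ⟨N, hN⟩ := hconv k (ε / 3) hε3
  have hφN : ∀ᶠ i in atTop, N ≤ φ i := hφ.tendsto_atTop.eventually_ge_atTop N
  -- Here `m` runs through the whole sequence; it is compared with the limit via some `φ i ≥ N`, at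
  -- a cost below `ε / 3` by the Cauchy property.
  filter_upwards [eventually_ge_atTop N] with m hm
  refine Metric.hausdorffEDist_le_of_mem_edist (fun τ hτ => ?_) fun τ hτ => ?_
  · obtain ⟨n, hn⟩ := hb k m τ hτ (ε / 3) hε3
    obtain ⟨τ', hτ', hlim⟩ := h.exists_mem_profile_tendsto hp' hC hν'
      (fun j : Fin k => (⟨k, m, n, j⟩ : Σ k : ℕ, ℕ × ℕ × Fin k))
    -- The index `n` does not depend on `i`, so the bound persists as `i → ∞`. The thirds pay for
    -- density, the Hausdorff distance and the slack `1 / (φ i + 1)`.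
    refine ⟨τ', hτ', le_of_tendsto (tendsto_const_nhds.edist hlim) ?_⟩
    have hinv : Tendsto (fun i => (φ i + 1 : ℝ≥0∞)⁻¹) atTop (𝓝 0) := by
      have := ((ENNReal.tendsto_inv_nat_nhds_zero.comp (tendsto_add_atTop_nat 1)).comp
        hφ.tendsto_atTop)
      refine this.congr fun i => ?_
      simp
    filter_upwards [hφN, hinv.eventually (gt_mem_nhds hε3)] with i hi hi'
    calc _ ≤ _ := hn (φ i)
      _ ≤ ε / 3 + (ε / 3 + ε / 3) := by
        gcongr
        exact (hN m hm _ hi).le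
      _ = ε := by rw [← add_assoc, ENNReal.add_thirds]
  · obtain ⟨i, ⟨η, hη, hτη⟩, hi⟩ := ((h.eventually_exists_mem_profile hp' hC hν'
      (fun i => hA (φ i)) hτ hε3.ne').and hφN).exists
    obtain ⟨η', hη', hlt⟩ := Metric.exists_edist_lt_of_hausdorffEDist_lt hη (hN _ hi m hm)
    refine ⟨η', hη', (edist_triangle τ η η').trans ?_⟩
    calc edist τ η + edist η η' ≤ ε / 3 + ε / 3 + 0 := by
          rw [add_zero]
          exact add_le_add hτη hlt.le
      _ ≤ ε / 3 + ε / 3 + ε / 3 := by gcongr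
      _ = ε := ENNReal.add_thirds ε

end ActionConvergence

end

theorem theorem2p9 {p q : ℝ≥0∞} (hp : 1 ≤ p) (hp_top : p ≠ ∞) (hq : 1 ≤ q)
    {Ω : ℕ → Type*} [∀ i, MeasurableSpace (Ω i)] {μ : ∀ i, Measure (Ω i)}
    [∀ i, IsProbabilityMeasure (μ i)] (A : ∀ i, ActionConvergence.POperator (μ i))
    (hconv : ActionConvergence.ActionConvergent A)
    (hbdd : ∃ c : ℝ≥0, ∀ i, ActionConvergence.opNorm p q (A i) ≤ c) :
    ∃ (Ω' : Type) (_ : MeasurableSpace Ω') (κ : Measure Ω') (_ : IsProbabilityMeasure κ)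
      (B : ActionConvergence.POperator κ),
      Tendsto (fun i => ActionConvergence.dM (A i) B) atTop (𝓝 0) ∧
      ActionConvergence.opNorm p q B ≤ ⨆ i, ActionConvergence.opNorm p q (A i) := by
  obtain ⟨c, hc⟩ := hbdd
  exact ActionConvergence.exists_limit_operator hp hp_top hq A hconv
    ((iSup_le hc).trans_lt ENNReal.coe_lt_top).ne
    (le_iSup fun i => ActionConvergence.opNorm p q (A i))
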